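/- Let $\mathbb{D}^n=\{z\in\mathbb{C}^n:|z_j|<1,\ 1\le j\le n\}$ be the polydisc and $\mathbb{T}^n=\{z\in\mathbb{C}^n:|z_j|=1,\ 1\le j\le n\}$ its distinguished boundary, equipped with the Lebesgue measure $d\theta_1\cdots d\theta_n$ (where $z_j=e^{i\theta_j}$). Let $G$ be a finite subgroup of the unitary group $U(n)$ that is generated by rotations $z\mapsto(e^{i\beta_1}z_1,\dots,e^{i\beta_n}z_n)$, $\beta\in\mathbb{R}^n$, and coordinate permutations $z\mapsto(z_{\kappa(1)},\dots,z_{\kappa(n)})$, $\kappa\in S_n$. A function $f$ on $\mathbb{D}^n$ or on $\mathbb{T}^n$ is called $G$-invariant if $f(\tau z)=f(z)$ for all $\tau\in G$ and all $z$ in its domain. A $G$-invariant function $w\ge 0$ on $\mathbb{T}^n$ is called admissible if there is a nowhere vanishing $G$-invariant holomorphic function $g$ on $\mathbb{D}^n$ such that the radial limit $g^*(z)=\lim_{r\to1^-}g(rz)$ exists for almost every $z\in\mathbb{T}^n$ and $|g^*|^2=w$ almost everywhere on $\mathbb{T}^n$. Theorem. Let $w$ be a real-valued, continuous, $G$-invariant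 function on $\mathbb{T}^n$ that is positive almost everywhere. If $\log w\in L^1(\mathbb{T}^n)$, then $w$ is admissible. -/

import Mathlib

open MeasureTheory Filter Topology
open scoped Matrix

noncomputable section

/-- The open unit polydisc `𝔻ⁿ ⊆ ℂⁿ`. -/
def polydisc (n : ℕ) : Set (Fin n → ℂ) := {z | ∀ i, ‖z i‖ < 1}

/-- The torus `𝕋ⁿ ⊆ ℂⁿ`, i.e. the distinguished boundary of the polydisc. -/
def torus (n : ℕ) : Set (Fin n → ℂ) := {z | ∀ i, ‖z i‖ = 1}

/-- Arc length on the unit circle, as a measure on `ℂ`: the image of Lebesgue measure on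
`(0, 2π]` under `θ ↦ exp (i θ)`. -/
def circleArcLength : Measure ℂ :=
  (volume.restrict (Set.Ioc (0 : ℝ) (2 * Real.pi))).map
    (fun θ : ℝ => Complex.exp (θ * Complex.I))

/-- The Lebesgue measure `dθ₁ ⋯ dθₙ` of the torus `𝕋ⁿ`, as a measure on `ℂⁿ` carried by `𝕋ⁿ`. -/
def torusMeasure (n : ℕ) : Measure (Fin n → ℂ) := Measure.pi (fun _ => circleArcLength)

/-- `τ ∈ U(n)` is a rotation: `τ z = (exp (i β₁) z₁, …, exp (i βₙ) zₙ)` for some real `β`. -/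
def IsRotation {n : ℕ} (τ : Matrix.unitaryGroup (Fin n) ℂ) : Prop :=
  ∃ β : Fin n → ℝ, ∀ (z : Fin n → ℂ) (i : Fin n),
    ((τ : Matrix (Fin n) (Fin n) ℂ) *ᵥ z) i = Complex.exp (β i * Complex.I) * z i

/-- `τ ∈ U(n)` is a permutation: `τ z = (z_{κ(1)}, …, z_{κ(n)})` for some permutation `κ` of the
indices. -/
def IsPermutation {n : ℕ} (τ : Matrix.unitaryGroup (Fin n) ℂ) : Prop :=
  ∃ κ : Equiv.Perm (Fin n), ∀ (z : Fin n → ℂ) (i : Fin n),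
    ((τ : Matrix (Fin n) (Fin n) ℂ) *ᵥ z) i = z (κ i)

/-- `G ≤ U(n)` is generated by (its) rotations and permutations. -/
def GeneratedByRotationsPermutations {n : ℕ}
    (G : Subgroup (Matrix.unitaryGroup (Fin n) ℂ)) : Prop :=
  Subgroup.closure {τ | τ ∈ G ∧ (IsRotation τ ∨ IsPermutation τ)} = G

/-- `f` is `G`-invariant on the set `A ⊆ ℂⁿ`: `f (τ z) = f z` for all `τ ∈ G` and `z ∈ A`. -/
def InvariantOn {n : ℕ} {α : Type*} (G : Subgroup (Matrix.unitaryGroup (Fin n) ℂ))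
    (A : Set (Fin n → ℂ)) (f : (Fin n → ℂ) → α) : Prop :=
  ∀ τ ∈ G, ∀ z ∈ A, f ((τ : Matrix (Fin n) (Fin n) ℂ) *ᵥ z) = f z

/-- `f` has the limit `c` along the radius ending at `z`: `f (r z) → c` as `r → 1⁻`. -/
def HasRadialLimit {n : ℕ} (f : (Fin n → ℂ) → ℂ) (z : Fin n → ℂ) (c : ℂ) : Prop :=
  Tendsto (fun r : ℝ => f (r • z)) (𝓝[<] 1) (𝓝 c)

/-- A function `w` on the torus is admissible for `G` (on the polydisc) if there is a
nowhere vanishing `G`-invariant holomorphic function `g` on the polydisc whose radial limit `g*`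
exists almost everywhere on the torus and satisfies `|g*|² = w` almost everywhere. -/
def IsAdmissible {n : ℕ} (G : Subgroup (Matrix.unitaryGroup (Fin n) ℂ))
    (w : (Fin n → ℂ) → ℝ) : Prop :=
  ∃ g : (Fin n → ℂ) → ℂ,
    DifferentiableOn ℂ g (polydisc n) ∧
    (∀ z ∈ polydisc n, g z ≠ 0) ∧
    InvariantOn G (polydisc n) g ∧
    ∃ gstar : (Fin n → ℂ) → ℂ,
      (∀ᵐ z ∂(torusMeasure n), HasRadialLimit g z (gstar z)) ∧
      (∀ᵐ z ∂(torusMeasure n), ‖gstar z‖ ^ 2 = w z)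

end

/-! It suffices to find `H` holomorphic on the polydisc whose radial limits have real part `log w`
almost everywhere: then `g = exp (A H / 2)`, with `A` the average over `G`, is invariant, has no
zeros and satisfies `|g*|² = w`. For `n > 1` the Poisson integral of `log w` need not be
pluriharmonic, so `H` is built as a series (`exists_holomorphic_radialLimit_re`). Approximate `log
w` by real Laurent polynomials `S k` and realise each difference `Q = S (k+1) - S k` as a boundary
real part. With `m = z₁ ⋯ zₙ` and `P = m ^ N * Q` on the torus, take `h = -2 P m^M / (1 - m^(N+M))`.
Since `u / (1 - u)` has real part `-1/2` on the unit circle, `Re h = Q` there; a large `M` makes `h`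
small on compact sets, and where `Q` is small so is `h` along the radius, unless `m^(N+M)` is near
`1` (`exists_holomorphic_small`). Borel–Cantelli then controls the series on almost every radius. -/

/-! ### Torus measure and the monomial action of `G`. -/

theorem circleArcLength_eq_map_addCircle [Fact (0 < 2 * Real.pi)] :
    circleArcLength = (volume : Measure (AddCircle (2 * Real.pi))).map
      (fun θ => (AddCircle.toCircle θ : ℂ)) := by
  have h := (AddCircle.measurePreserving_mk (2 * Real.pi) 0).map_eq
  rw [zero_add] at h
  rw [← h, Measure.map_map (by fun_prop) AddCircle.measurable_mk', circleArcLength]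
  congr 1
  funext θ
  simp only [Function.comp_apply, AddCircle.toCircle_apply_mk, Circle.coe_exp]
  congr 2
  field_simp

instance : IsFiniteMeasure circleArcLength := by
  unfold circleArcLength
  infer_instance

instance (n : ℕ) : IsFiniteMeasure (torusMeasure n) := by
  unfold torusMeasure
  infer_instance

theorem ae_circleArcLength_norm_eq_one : ∀ᵐ z ∂circleArcLength, ‖z‖ = 1 := by
  rw [circleArcLength, ae_map_iff (by fun_prop) (measurableSet_eq_fun (by fun_prop) (by fun_prop))]
  exact Eventually.of_forall fun θ => Complex.norm_exp_ofReal_mul_I θ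

theorem ae_mem_torus (n : ℕ) : ∀ᵐ z ∂torusMeasure n, z ∈ torus n := by
  unfold torusMeasure
  refine eventually_all.2 fun i => ?_
  exact (Measure.tendsto_eval_ae_ae (μ := fun _ : Fin n => circleArcLength) (i := i)).eventually
    ae_circleArcLength_norm_eq_one

theorem measurePreserving_mul_circleArcLength (c : ℂ) (hc : ‖c‖ = 1) :
    MeasurePreserving (fun z => c * z) circleArcLength circleArcLength := by
  have : Fact (0 < 2 * Real.pi) := ⟨Real.two_pi_pos⟩
  refine ⟨by fun_prop, ?_⟩
  obtain ⟨β, hβ⟩ : ∃ β : AddCircle (2 * Real.pi), (AddCircle.toCircle β : ℂ) = c := by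
    refine ⟨((Complex.arg c : ℝ) : AddCircle (2 * Real.pi)), ?_⟩
    rw [AddCircle.toCircle_apply_mk, Circle.coe_exp]
    have h := Complex.norm_mul_exp_arg_mul_I c
    rw [hc, Complex.ofReal_one, one_mul] at h
    rw [← h]
    congr 2
    rw [h]
    field_simp
  rw [circleArcLength_eq_map_addCircle, Measure.map_map (by fun_prop) (by fun_prop)]
  conv_rhs => rw [← map_add_left_eq_self (volume : Measure (AddCircle (2 * Real.pi))) β]
  rw [Measure.map_map (by fun_prop) (by fun_prop)]
  congr 1
  funext θ
  simp [AddCircle.toCircle_add, hβ]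

/-- The map `z ↦ (c₁ z_{κ(1)}, …, cₙ z_{κ(n)})`. -/
def monomialMap {n : ℕ} (c : Fin n → ℂ) (κ : Equiv.Perm (Fin n)) (z : Fin n → ℂ) : Fin n → ℂ :=
  fun i => c i * z (κ i)

theorem measurePreserving_monomialMap {n : ℕ} (c : Fin n → ℂ) (κ : Equiv.Perm (Fin n))
    (hc : ∀ i, ‖c i‖ = 1) :
    MeasurePreserving (monomialMap c κ) (torusMeasure n) (torusMeasure n) := by
  have h1 := measurePreserving_pi (fun _ : Fin n => circleArcLength) (fun _ => circleArcLength)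
    (fun i => measurePreserving_mul_circleArcLength (c i) (hc i))
  have h2 := measurePreserving_piCongrLeft (fun _ : Fin n => circleArcLength) κ.symm
  have h3 := h1.comp h2
  unfold torusMeasure
  convert h3 using 1
  funext z i
  simp only [monomialMap, Function.comp_apply]
  congr 1
  have := MeasurableEquiv.piCongrLeft_apply_apply (β := fun _ : Fin n => ℂ) κ.symm z (κ i)
  simpa using this.symm

theorem monomialMap_mem_polydisc {n : ℕ} {c : Fin n → ℂ} {κ : Equiv.Perm (Fin n)}
    (hc : ∀ i, ‖c i‖ = 1) {z : Fin n → ℂ} (hz : z ∈ polydisc n) :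
    monomialMap c κ z ∈ polydisc n := by
  intro i
  simpa [monomialMap, hc i] using hz (κ i)

/-- Monomial maps with unimodular coefficients include the generators and are closed under
composition and inverse. -/
theorem exists_monomialMap_of_mem {n : ℕ} {G : Subgroup (Matrix.unitaryGroup (Fin n) ℂ)}
    (hG : GeneratedByRotationsPermutations G) {τ : Matrix.unitaryGroup (Fin n) ℂ} (hτ : τ ∈ G) :
    ∃ (c : Fin n → ℂ) (κ : Equiv.Perm (Fin n)), (∀ i, ‖c i‖ = 1) ∧
      ∀ z, (τ : Matrix (Fin n) (Fin n) ℂ) *ᵥ z = monomialMap c κ z := by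
  rw [← hG] at hτ
  induction hτ using Subgroup.closure_induction with
  | mem τ h =>
    rcases h.2 with ⟨β, hβ⟩ | ⟨κ, hκ⟩
    · exact ⟨fun i => Complex.exp (β i * Complex.I), 1,
        fun i => Complex.norm_exp_ofReal_mul_I _, fun z => funext fun i => hβ z i⟩
    · exact ⟨fun _ => 1, κ, fun _ => norm_one, fun z => funext fun i => by
        simp [monomialMap, hκ z i]⟩
  | one => exact ⟨fun _ => 1, 1, fun _ => norm_one, fun z => funext fun i => by simp [monomialMap]⟩
  | mul σ τ _ _ hσ hτ =>
    obtain ⟨c, κ, hc, h⟩ := hσ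
    obtain ⟨c', κ', hc', h'⟩ := hτ
    refine ⟨fun i => c i * c' (κ i), κ.trans κ', fun i => by simp [hc, hc'], fun z => ?_⟩
    rw [Submonoid.coe_mul, ← Matrix.mulVec_mulVec, h', h]
    funext i
    simp [monomialMap, mul_assoc]
  | inv τ _ hτ =>
    obtain ⟨c, κ, hc, h⟩ := hτ
    refine ⟨fun i => (c (κ.symm i))⁻¹, κ.symm, fun i => by simp [hc], fun z => ?_⟩
    funext i
    have h1 : (τ : Matrix (Fin n) (Fin n) ℂ) *ᵥ
        ((τ⁻¹ : Matrix.unitaryGroup (Fin n) ℂ) *ᵥ z : Fin n → ℂ) = z := by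
      rw [Matrix.mulVec_mulVec, ← Submonoid.coe_mul, mul_inv_cancel]
      simp
    rw [h] at h1
    have h2 := congrFun h1 (κ.symm i)
    have h3 : c (κ.symm i) ≠ 0 := norm_ne_zero_iff.1 (by simp [hc])
    simp only [monomialMap, Equiv.apply_symm_apply] at h2 ⊢
    rw [← h2]
    field_simp

/-! ### Holomorphic series on the unit ball. -/

theorem polydisc_eq_ball (n : ℕ) : polydisc n = Metric.ball 0 1 := by
  ext z
  simp [polydisc, pi_norm_lt_iff]

/-- A series of holomorphic functions on the unit ball whose terms are eventually dominated by a
summable sequence on every smaller ball is holomorphic. -/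
theorem differentiableOn_tsum_ball {E : Type*} [NormedAddCommGroup E] [NormedSpace ℂ E]
    [ProperSpace E] {h : ℕ → E → ℂ} {u : ℕ → ℝ} (hu : Summable u)
    (hd : ∀ k, DifferentiableOn ℂ (h k) (Metric.ball 0 1))
    (hb : ∀ ρ < 1, ∀ᶠ k in atTop, ∀ z, ‖z‖ ≤ ρ → ‖h k z‖ ≤ u k) :
    DifferentiableOn ℂ (fun z => ∑' k, h k z) (Metric.ball 0 1) := by
  let _ : NormedSpace ℝ E := NormedSpace.restrictScalars ℝ ℂ E
  intro z hz
  rw [mem_ball_zero_iff] at hz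
  obtain ⟨ρ, hzρ, hρ1⟩ := exists_between hz
  obtain ⟨ρ', hρρ', hρ'1⟩ := exists_between hρ1
  have hC : ∀ k, ∃ C, ∀ z, ‖z‖ ≤ ρ' → ‖h k z‖ ≤ C := fun k => by
    obtain ⟨C, hC⟩ := (isCompact_closedBall (0 : E) ρ').exists_bound_of_continuousOn
      ((hd k).continuousOn.mono (Metric.closedBall_subset_ball hρ'1))
    exact ⟨C, fun z hz => hC z (mem_closedBall_zero_iff.2 hz)⟩
  choose C hC using hC
  obtain ⟨k₀, hk₀⟩ := eventually_atTop.1 (hb ρ' hρ'1)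
  -- The finitely many terms not dominated by `u` are bounded by compactness.
  set v : ℕ → ℝ := fun k => if k < k₀ then C k else u k with hv
  have hvs : Summable v := by
    refine (summable_congr_cofinite ?_).1 hu
    rw [Nat.cofinite_eq_atTop]
    filter_upwards [eventually_ge_atTop k₀] with k hk
    simp [hv, hk.not_gt]
  have hvb : ∀ k z, ‖z‖ ≤ ρ' → ‖h k z‖ ≤ v k := fun k z hz => by
    by_cases hk : k < k₀
    · simpa [hv, hk] using hC k z hz
    · simpa [hv, hk] using hk₀ k (not_lt.1 hk) z hz
  have hsum : Summable (fun k => 2 * v k / (ρ' - ρ)) := (hvs.mul_left 2).div_const _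
  have hda : ∀ k, ∀ x ∈ Metric.ball (0 : E) ρ, HasFDerivAt (h k) (fderiv ℂ (h k) x) x :=
    fun k x hx => ((hd k).differentiableAt (Metric.isOpen_ball.mem_nhds
      (Metric.ball_subset_ball hρ1.le hx))).hasFDerivAt
  refine (hasFDerivAt_tsum_of_isPreconnected (x₀ := z) hsum Metric.isOpen_ball
    (convex_ball (0 : E) ρ).isPreconnected hda (fun k x hx => ?_) (mem_ball_zero_iff.2 hzρ)
    (Summable.of_norm_bounded hvs fun k => hvb k z (hzρ.trans hρρ').le)
    (mem_ball_zero_iff.2 hzρ)).differentiableAt.differentiableWithinAt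
  rw [mem_ball_zero_iff] at hx
  have hsub : ∀ y ∈ Metric.ball x (ρ' - ρ), ‖y‖ ≤ ρ' := fun y hy => by
    rw [mem_ball_iff_norm] at hy
    calc ‖y‖ = ‖(y - x) + x‖ := by simp
      _ ≤ ‖y - x‖ + ‖x‖ := norm_add_le _ _
      _ ≤ ρ' := by linarith
  -- Cauchy estimate: on the ball of radius `ρ' - ρ` about `x`, `h k` varies from `h k x` by at most
  -- `2 * v k`.
  refine Complex.norm_fderiv_le_div_of_mapsTo_ball ((hd k).mono fun y hy =>
    mem_ball_zero_iff.2 ((hsub y hy).trans_lt hρ'1)) (fun y hy => ?_) (by linarith)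
  rw [mem_closedBall_iff_norm]
  have h1 := hvb k y (hsub y hy)
  have h2 := hvb k x (hx.trans hρρ').le
  have h3 := norm_sub_le (h k y) (h k x)
  linarith

/-! ### Approximation by Laurent polynomials. -/

/-- A real function on the torus that is given by a Laurent polynomial, or more generally becomes
the restriction of an entire function after multiplication by a power of `z₁ ⋯ zₙ`. -/
def IsLaurentOnTorus {n : ℕ} (Q : (Fin n → ℂ) → ℝ) : Prop :=
  ∃ (N : ℕ) (P : (Fin n → ℂ) → ℂ), Differentiable ℂ P ∧
    ∀ z ∈ torus n, P z = (∏ i, z i) ^ N * (Q z : ℂ)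

namespace IsLaurentOnTorus

variable {n : ℕ} {Q Q' : (Fin n → ℂ) → ℝ}

theorem const (c : ℝ) : IsLaurentOnTorus (fun _ : Fin n → ℂ => c) :=
  ⟨0, fun _ => (c : ℂ), by fun_prop, fun z _ => by simp⟩

theorem add (h : IsLaurentOnTorus Q) (h' : IsLaurentOnTorus Q') :
    IsLaurentOnTorus (fun z => Q z + Q' z) := by
  obtain ⟨N, P, hP, hQ⟩ := h
  obtain ⟨N', P', hP', hQ'⟩ := h'
  refine ⟨N + N', fun z => (∏ i, z i) ^ N' * P z + (∏ i, z i) ^ N * P' z, by fun_prop,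
    fun z hz => ?_⟩
  simp only [hQ z hz, hQ' z hz, Complex.ofReal_add]
  ring

theorem mul (h : IsLaurentOnTorus Q) (h' : IsLaurentOnTorus Q') :
    IsLaurentOnTorus (fun z => Q z * Q' z) := by
  obtain ⟨N, P, hP, hQ⟩ := h
  obtain ⟨N', P', hP', hQ'⟩ := h'
  refine ⟨N + N', fun z => P z * P' z, by fun_prop, fun z hz => ?_⟩
  simp only [hQ z hz, hQ' z hz, Complex.ofReal_mul]
  ring

theorem sub (h : IsLaurentOnTorus Q) (h' : IsLaurentOnTorus Q') :
    IsLaurentOnTorus (fun z => Q z - Q' z) := by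
  convert h.add ((const (-1)).mul h') using 2
  ring

/-- On the torus `conj (z i) = 1 / z i`, so one factor `∏ j, z j` clears the denominator. -/
theorem conj_mul_prod {z : Fin n → ℂ} (hz : z ∈ torus n) (i : Fin n) :
    (starRingEnd ℂ) (z i) * ∏ j, z j = ∏ j ∈ Finset.univ.erase i, z j := by
  rw [← Finset.mul_prod_erase Finset.univ z (Finset.mem_univ i), ← mul_assoc,
    ← Complex.normSq_eq_conj_mul_self, Complex.normSq_eq_norm_sq, hz i]
  simp

theorem re_apply (i : Fin n) : IsLaurentOnTorus (fun z : Fin n → ℂ => (z i).re) := by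
  refine ⟨1, fun z => (z i * (∏ j, z j) + ∏ j ∈ Finset.univ.erase i, z j) / 2, by fun_prop,
    fun z hz => ?_⟩
  simp only [← conj_mul_prod hz i, Complex.re_eq_add_conj]
  ring

theorem im_apply (i : Fin n) : IsLaurentOnTorus (fun z : Fin n → ℂ => (z i).im) := by
  refine ⟨1, fun z => (z i * (∏ j, z j) - ∏ j ∈ Finset.univ.erase i, z j) / (2 * Complex.I),
    by fun_prop, fun z hz => ?_⟩
  simp only [← conj_mul_prod hz i, Complex.im_eq_sub_conj]
  ring

end IsLaurentOnTorus

/-- The algebra of continuous functions that are given by Laurent polynomials on the torus. -/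
def laurentSubalgebra (n : ℕ) : Subalgebra ℝ C(Fin n → ℂ, ℝ) where
  carrier := {Q | IsLaurentOnTorus Q}
  mul_mem' h h' := h.mul h'
  add_mem' h h' := h.add h'
  algebraMap_mem' c := IsLaurentOnTorus.const c

theorem laurentSubalgebra_separatesPoints (n : ℕ) : (laurentSubalgebra n).SeparatesPoints := by
  intro x y hxy
  obtain ⟨i, hi⟩ := Function.ne_iff.1 hxy
  by_cases h : (x i).re = (y i).re
  · exact ⟨_, ⟨⟨fun z => (z i).im, by fun_prop⟩, IsLaurentOnTorus.im_apply i, rfl⟩,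
      fun him => hi (Complex.ext h him)⟩
  · exact ⟨_, ⟨⟨fun z => (z i).re, by fun_prop⟩, IsLaurentOnTorus.re_apply i, rfl⟩, h⟩

theorem isCompact_torus (n : ℕ) : IsCompact (torus n) := by
  have h : torus n = Set.univ.pi fun _ => Metric.sphere (0 : ℂ) 1 := by
    ext z
    simp [torus]
  rw [h]
  exact isCompact_univ_pi fun _ => isCompact_sphere 0 1

/-- Density of `C_c` in `L¹`, then Stone–Weierstrass on the torus. Each spends `η / 2` of the error;
Markov's inequality at level `η / 2` explains the `L¹` bound `η / 2 * η`. -/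
theorem exists_isLaurentOnTorus_measure_le {n : ℕ} {φ : (Fin n → ℂ) → ℝ}
    (hφ : Integrable φ (torusMeasure n)) {η : ℝ} (hη : 0 < η) :
    ∃ Q, IsLaurentOnTorus Q ∧
      torusMeasure n {z | z ∈ torus n ∧ η < |φ z - Q z|} ≤ ENNReal.ofReal η := by
  obtain ⟨f, -, hf, hfc, hfi⟩ := hφ.exists_hasCompactSupport_integral_sub_le
    (show 0 < η / 2 * η by positivity)
  obtain ⟨Q, hQ, hQf⟩ :=
    ContinuousMap.exists_mem_subalgebra_near_continuous_of_isCompact_of_separatesPoints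
      (laurentSubalgebra_separatesPoints n) ⟨f, hfc⟩ (isCompact_torus n) (half_pos hη)
  refine ⟨Q, hQ, ?_⟩
  have h1 := mul_meas_ge_le_integral_of_nonneg (μ := torusMeasure n)
    (Eventually.of_forall fun z => norm_nonneg (φ z - f z)) (hφ.sub hfi).norm (η / 2)
  have h2 : (torusMeasure n).real {z | η / 2 ≤ ‖φ z - f z‖} ≤ η :=
    le_of_mul_le_mul_left (h1.trans hf) (half_pos hη)
  refine (measure_mono fun z hz => ?_).trans ((ENNReal.le_ofReal_iff_toReal_le
    (measure_ne_top _ _) hη.le).2 h2)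
  have h3 := hQf z hz.1
  have h4 : |φ z - Q z| ≤ ‖φ z - f z‖ + ‖Q z - f z‖ := by
    simpa using abs_sub_le (φ z) (f z) (Q z) |>.trans_eq (by rw [abs_sub_comm (f z)])
  have h5 := hz.2
  simp only [ContinuousMap.coe_mk] at h3
  simp only [Set.mem_ofPred_eq]
  linarith

/-! ### The building block with prescribed boundary real part. -/

theorem norm_prod_of_mem_torus {n : ℕ} {z : Fin n → ℂ} (hz : z ∈ torus n) :
    ‖∏ i, z i‖ = 1 := by
  rw [norm_prod]
  exact Finset.prod_eq_one fun i _ => hz i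

theorem norm_prod_le_norm {n : ℕ} (hn : n ≠ 0) {z : Fin n → ℂ} (hz : ‖z‖ ≤ 1) :
    ‖∏ i, z i‖ ≤ ‖z‖ := by
  rw [norm_prod]
  calc ∏ i, ‖z i‖ ≤ ∏ _i : Fin n, ‖z‖ :=
        Finset.prod_le_prod (fun _ _ => norm_nonneg _) fun i _ => norm_le_pi_norm z i
    _ = ‖z‖ ^ n := by simp
    _ ≤ ‖z‖ := pow_le_of_le_one (norm_nonneg _) hz hn

/-- The sets where a power of `z₁ ⋯ zₙ` is close to `1` are uniformly small. -/
theorem exists_measure_norm_one_sub_prod_pow_lt_le {n : ℕ} (hn : n ≠ 0) {ε : ℝ} (hε : 0 < ε) :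
    ∃ c > 0, ∀ K : ℕ, K ≠ 0 →
      torusMeasure n {z | ‖1 - (∏ i, z i) ^ K‖ < c} ≤ ENNReal.ofReal ε := by
  -- The set has `L` disjoint rotated copies of equal measure, one near each `L`-th root of unity,
  -- so its measure is at most the total over `L`. The separation `c` depends on `L` only, not on
  -- `K`.
  obtain ⟨L, hL⟩ := exists_nat_gt ((torusMeasure n).real Set.univ / ε)
  have hL0 : L ≠ 0 := by
    rintro rfl
    rw [Nat.cast_zero] at hL
    exact absurd hL (not_lt.2 (by positivity))
  set ζ : ℂ := Complex.exp (2 * Real.pi * Complex.I / L)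
  have hζ : IsPrimitiveRoot ζ L := Complex.isPrimitiveRoot_exp L hL0
  have hζ1 : ‖ζ‖ = 1 := hζ.norm'_eq_one hL0
  obtain ⟨c, hsep, hc⟩ : ∃ c : ℝ, (∀ i j : Fin L, i ≠ j → 2 * c < ‖ζ ^ (i : ℕ) - ζ ^ (j : ℕ)‖) ∧
      0 < c := by
    have h : ∀ᶠ c : ℝ in 𝓝[>] 0, ∀ i j : Fin L, i ≠ j →
        2 * c < ‖ζ ^ (i : ℕ) - ζ ^ (j : ℕ)‖ := by
      refine eventually_all.2 fun i => eventually_all.2 fun j => ?_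
      by_cases hij : i = j
      · simp [hij]
      have hpos : 0 < ‖ζ ^ (i : ℕ) - ζ ^ (j : ℕ)‖ := norm_pos_iff.2 (sub_ne_zero.2 fun h =>
        hij (Fin.ext (hζ.pow_inj i.2 j.2 h)))
      have ht : Tendsto (fun c : ℝ => 2 * c) (𝓝[>] 0) (𝓝 0) := by
        have h0 : Continuous (fun c : ℝ => 2 * c) := by fun_prop
        exact (h0.tendsto' 0 0 (mul_zero 2)).mono_left nhdsWithin_le_nhds
      filter_upwards [ht.eventually_lt_const hpos] with c hc _ using hc
    exact (h.and self_mem_nhdsWithin).exists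
  refine ⟨c, hc, fun K hK => ?_⟩
  set E : Fin L → Set (Fin n → ℂ) := fun j => {z | ‖ζ ^ (j : ℕ) - (∏ i, z i) ^ K‖ < c} with hE
  have hEm : ∀ j, MeasurableSet (E j) := fun j =>
    measurableSet_lt (by fun_prop) measurable_const
  have hEeq : ∀ j, torusMeasure n (E j) = torusMeasure n {z | ‖1 - (∏ i, z i) ^ K‖ < c} := by
    intro j
    -- Rotating one coordinate by a `K`-th root of `ζ ^ j` multiplies `(∏ i, z i) ^ K` by `ζ ^ j`.
    obtain ⟨ω, hω⟩ := IsAlgClosed.exists_pow_nat_eq (ζ ^ (j : ℕ)) (Nat.pos_of_ne_zero hK)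
    have hω1 : ‖ω‖ = 1 := by
      have h : ‖ω‖ ^ K = 1 := by rw [← norm_pow, hω, norm_pow, hζ1, one_pow]
      exact (pow_eq_one_iff_of_nonneg (norm_nonneg _) hK).1 h
    have hmp := measurePreserving_monomialMap
      (fun i : Fin n => if i = ⟨0, Nat.pos_of_ne_zero hn⟩ then ω else 1) 1
      (fun i => by split_ifs <;> simp [hω1])
    rw [← hmp.measure_preimage (hEm j).nullMeasurableSet]
    congr 1
    ext z
    simp only [hE, Set.mem_preimage, Set.mem_ofPred_eq, monomialMap, Finset.prod_mul_distrib,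
      Finset.prod_ite_eq', Finset.mem_univ, if_true, Equiv.Perm.coe_one, id_eq, mul_pow, hω]
    rw [← mul_one_sub, norm_mul, norm_pow, hζ1, one_pow, one_mul]
  have hdisj : Pairwise (Function.onFun Disjoint E) := by
    intro i j hij
    refine Set.disjoint_left.2 fun z hi hj => ?_
    have h1 : ‖ζ ^ (i : ℕ) - (∏ i, z i) ^ K‖ < c := hi
    have h2 : ‖ζ ^ (j : ℕ) - (∏ i, z i) ^ K‖ < c := hj
    have h3 := hsep i j hij
    have h4 := norm_sub_le (ζ ^ (i : ℕ) - (∏ i, z i) ^ K) (ζ ^ (j : ℕ) - (∏ i, z i) ^ K)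
    rw [sub_sub_sub_cancel_right] at h4
    linarith
  have hsum : ∑ j, (torusMeasure n).real (E j) ≤ (torusMeasure n).real Set.univ :=
    sum_measureReal_le_measureReal_univ (fun j _ => hEm j)
      (fun i _ j _ hij => hdisj hij)
  simp only [measureReal_def, hEeq, Finset.sum_const, Finset.card_univ, Fintype.card_fin,
    nsmul_eq_mul] at hsum
  rw [ENNReal.le_ofReal_iff_toReal_le (measure_ne_top _ _) hε.le]
  rw [div_lt_iff₀ hε, measureReal_def] at hL
  exact le_of_mul_le_mul_left (hsum.trans hL.le) (by positivity)

theorem ae_prod_pow_ne_one {n : ℕ} (hn : n ≠ 0) {K : ℕ} (hK : K ≠ 0) :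
    ∀ᵐ z ∂torusMeasure n, (∏ i, z i) ^ K ≠ 1 := by
  rw [ae_iff]
  refine le_antisymm (ENNReal.le_of_forall_pos_le_add fun ε hε _ => ?_) zero_le
  obtain ⟨c, hc, h⟩ := exists_measure_norm_one_sub_prod_pow_lt_le hn (NNReal.coe_pos.2 hε)
  rw [zero_add, ← ENNReal.ofReal_coe_nnreal]
  refine (measure_mono fun z hz => ?_).trans (h K hK)
  have hz' : (∏ i, z i) ^ K = 1 := not_not.1 hz
  simpa [hz'] using hc

theorem re_div_one_sub_of_norm_eq_one {u : ℂ} (hu : ‖u‖ = 1) (hu1 : u ≠ 1) :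
    (u / (1 - u)).re = -1 / 2 := by
  have hu0 : u ≠ 0 := norm_ne_zero_iff.1 (by simp [hu])
  have h1 : 1 - u ≠ 0 := sub_ne_zero.2 hu1.symm
  have h2 : u - 1 ≠ 0 := sub_ne_zero.2 hu1
  have h : ((u / (1 - u)).re : ℂ) = ((-1 / 2 : ℝ) : ℂ) := by
    rw [Complex.re_eq_add_conj]
    simp only [map_div₀, map_sub, map_one, ← Complex.inv_eq_conj hu]
    have h3 : u⁻¹ / (1 - u⁻¹) = 1 / (u - 1) := by
      have : 1 - u⁻¹ = (u - 1) / u := by field_simp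
      rw [this]
      field_simp
    rw [h3, ← neg_sub 1 u, div_neg]
    push_cast
    field_simp
    ring
  exact_mod_cast h

/-- Keeps the denominator of the block away from zero along a whole radius. -/
theorem norm_one_sub_le_two_mul {u : ℂ} (hu : ‖u‖ = 1) {ρ : ℝ} (h0 : 0 ≤ ρ) (h1 : ρ ≤ 1) :
    ‖1 - u‖ ≤ 2 * ‖1 - ρ * u‖ := by
  have h2 : ‖1 - u‖ ≤ ‖1 - ρ * u‖ + ‖(ρ - 1 : ℂ) * u‖ := by
    refine (norm_add_le _ _).trans_eq' ?_
    congr 1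
    ring
  have h3 : ‖(ρ - 1 : ℂ) * u‖ = 1 - ρ := by
    rw [norm_mul, hu, mul_one, ← Complex.ofReal_one, ← Complex.ofReal_sub, Complex.norm_real,
      Real.norm_eq_abs, abs_sub_comm, abs_of_nonneg (by linarith)]
  have h4 : 1 - ρ ≤ ‖1 - ρ * u‖ := by
    have h5 := norm_sub_norm_le (1 : ℂ) (ρ * u)
    rw [norm_one, norm_mul, hu, mul_one, Complex.norm_real, Real.norm_eq_abs] at h5
    rwa [abs_of_nonneg h0] at h5
  linarith

/-- A holomorphic function on the polydisc with prescribed real part on the torus that is small on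
compact subsets and, off a small set, on the radii where the prescribed real part is small. -/
theorem exists_holomorphic_small {n : ℕ} (hn : n ≠ 0) {ε : ℝ} (hε : 0 < ε) :
    ∃ δ > 0, ∀ Q : (Fin n → ℂ) → ℝ, IsLaurentOnTorus Q →
      ∃ h : (Fin n → ℂ) → ℂ, DifferentiableOn ℂ h (polydisc n) ∧
        (∀ z, ‖z‖ ≤ 1 - ε → ‖h z‖ ≤ ε) ∧
        (∀ᵐ z ∂torusMeasure n, ContinuousAt h z ∧ (h z).re = Q z) ∧
        ∃ E : Set (Fin n → ℂ), torusMeasure n E ≤ ENNReal.ofReal ε ∧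
          ∀ z ∈ torus n, z ∉ E → |Q z| ≤ δ → ∀ r ∈ Set.Ico (0 : ℝ) 1, ‖h (r • z)‖ ≤ ε := by
  obtain ⟨c, hc, hcm⟩ := exists_measure_norm_one_sub_prod_pow_lt_le hn hε
  have hδ : 0 < ε * c / 8 := by positivity
  -- Near the boundary `‖P‖ ≤ 2δ` and the denominator is at least `c / 2`, so `‖h‖ ≤ 8δ / c = ε`.
  refine ⟨ε * c / 8, hδ, fun Q ⟨N, P, hP, hPQ⟩ => ?_⟩
  have hcpt := isCompact_closedBall (0 : Fin n → ℂ) 1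
  obtain ⟨B, hB⟩ := hcpt.exists_bound_of_continuousOn hP.continuous.continuousOn
  have hB0 : 0 ≤ B := (norm_nonneg _).trans (hB 0 (by simp))
  obtain ⟨d, hd, hPd⟩ := Metric.uniformContinuousOn_iff.1
    (hcpt.uniformContinuousOn_of_continuous hP.continuous.continuousOn) _ hδ
  -- Radii up to `ρ` are handled by the decay of `m ^ M`, those beyond by uniform continuity of `P`;
  -- the outer `min` keeps `ρ ≥ 0`.
  set ρ : ℝ := 1 - min (min d ε) 1 with hρ
  have hρ0 : 0 ≤ ρ := sub_nonneg.2 (min_le_right _ _)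
  have hρ1 : ρ < 1 := sub_lt_self _ (by positivity)
  have hρd : 1 - d ≤ ρ := sub_le_sub_left ((min_le_left _ _).trans (min_le_left _ _)) 1
  have hρε : 1 - ε ≤ ρ := sub_le_sub_left ((min_le_left _ _).trans (min_le_right _ _)) 1
  obtain ⟨M, hM, hM0⟩ : ∃ M : ℕ, 2 * B * ρ ^ M / (1 - ρ ^ M) < ε ∧ M ≠ 0 := by
    have h1 := tendsto_pow_atTop_nhds_zero_of_lt_one hρ0 hρ1
    have h2 := (h1.const_mul (2 * B)).div (h1.const_sub 1) (by norm_num)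
    rw [mul_zero, zero_div] at h2
    exact ((h2.eventually_lt_const hε).and (eventually_ne_atTop 0)).exists
  have hK : N + M ≠ 0 := by omega
  set m : (Fin n → ℂ) → ℂ := fun z => ∏ i, z i with hm
  have hmd : Differentiable ℂ m := by fun_prop
  set h : (Fin n → ℂ) → ℂ := fun z => -2 * P z * m z ^ M / (1 - m z ^ (N + M)) with hh
  have hdiff : ∀ z, m z ^ (N + M) ≠ 1 → DifferentiableAt ℂ h z := fun z hz => by
    have h1 : 1 - m z ^ (N + M) ≠ 0 := sub_ne_zero.2 hz.symm
    simp only [hh, div_eq_mul_inv]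
    exact DifferentiableAt.mul (by fun_prop) (DifferentiableAt.inv (by fun_prop) h1)
  have hmpow : ∀ z, ‖z‖ < 1 → ‖m z ^ (N + M)‖ < 1 := fun z hz => by
    rw [norm_pow]
    exact pow_lt_one₀ (norm_nonneg _) ((norm_prod_le_norm hn hz.le).trans_lt hz) hK
  have hinner : ∀ z, ‖z‖ ≤ ρ → ‖h z‖ ≤ ε := fun z hz => by
    have hz1 : ‖z‖ ≤ 1 := hz.trans hρ1.le
    have h1 : ‖m z‖ ≤ ρ := (norm_prod_le_norm hn hz1).trans hz
    have h2 : ‖m z‖ ^ M ≤ ρ ^ M := pow_le_pow_left₀ (norm_nonneg _) h1 M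
    have h3 : ‖m z ^ (N + M)‖ ≤ ρ ^ M := by
      rw [norm_pow]
      exact (pow_le_pow_of_le_one (norm_nonneg _) (h1.trans hρ1.le) (by omega)).trans h2
    have h4 := norm_sub_norm_le (1 : ℂ) (m z ^ (N + M))
    rw [norm_one] at h4
    have h5 : ρ ^ M < 1 := pow_lt_one₀ hρ0 hρ1 hM0
    refine le_trans ?_ hM.le
    simp only [hh, norm_div, norm_mul, norm_neg, Complex.norm_ofNat, norm_pow (m z) M]
    have h6 := hB z (by simpa using hz1)
    exact div_le_div₀ (by positivity) (by gcongr) (by linarith) (by linarith)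
  refine ⟨h, fun z hz => ?_, fun z hz => hinner z (hz.trans hρε), ?_,
    {z | ‖1 - m z ^ (N + M)‖ < c}, hcm _ hK, fun z hz hzE hQz r hr => ?_⟩
  · rw [polydisc_eq_ball, mem_ball_zero_iff] at hz
    refine (hdiff z fun h1 => ?_).differentiableWithinAt
    have h2 := hmpow z hz
    rw [h1, norm_one] at h2
    exact lt_irrefl _ h2
  · filter_upwards [ae_mem_torus n, ae_prod_pow_ne_one hn hK] with z hz hz1
    refine ⟨(hdiff z hz1).continuousAt, ?_⟩
    have hu : ‖m z ^ (N + M)‖ = 1 := by rw [norm_pow, norm_prod_of_mem_torus hz, one_pow]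
    have h1 : h z = ((-2 * Q z : ℝ) : ℂ) * (m z ^ (N + M) / (1 - m z ^ (N + M))) := by
      simp only [hh, hPQ z hz, pow_add]
      push_cast
      ring
    rw [h1, Complex.re_ofReal_mul, re_div_one_sub_of_norm_eq_one hu hz1]
    ring
  · have hnz : ‖z‖ ≤ 1 := (pi_norm_le_iff_of_nonneg zero_le_one).2 fun i => (hz i).le
    have hnr : ‖r • z‖ ≤ r := by
      rw [norm_smul, Real.norm_of_nonneg hr.1]
      exact mul_le_of_le_one_right hr.1 hnz
    by_cases hrρ : r ≤ ρ
    · exact hinner _ (hnr.trans hrρ)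
    have hu : ‖m z ^ (N + M)‖ = 1 := by rw [norm_pow, norm_prod_of_mem_torus hz, one_pow]
    have h1 : m (r • z) ^ (N + M) = ((r ^ n) ^ (N + M) : ℝ) * m z ^ (N + M) := by
      simp only [hm, Pi.smul_apply, Complex.real_smul, Finset.prod_mul_distrib, mul_pow]
      simp
    have h2 : c ≤ 2 * ‖1 - m (r • z) ^ (N + M)‖ := by
      rw [h1]
      exact (not_lt.1 hzE).trans (norm_one_sub_le_two_mul hu (pow_nonneg (pow_nonneg hr.1 _) _)
        (pow_le_one₀ (pow_nonneg hr.1 _) (pow_le_one₀ hr.1 hr.2.le)))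
    have h3 : ‖P (r • z)‖ ≤ 2 * (ε * c / 8) := by
      have h4 : dist (P (r • z)) (P z) < ε * c / 8 := by
        refine hPd _ (by simpa using hnr.trans hr.2.le) z (by simpa using hnz) ?_
        have h5 : r • z - z = (r - 1) • z := by rw [sub_smul, one_smul]
        rw [dist_eq_norm, h5, norm_smul, Real.norm_eq_abs, abs_sub_comm,
          abs_of_pos (by linarith [hr.2])]
        refine (mul_le_of_le_one_right (by linarith [hr.2]) hnz).trans_lt ?_
        linarith [not_le.1 hrρ]
      have h6 : ‖P z‖ = |Q z| := by
        rw [hPQ z hz, norm_mul, norm_pow, norm_prod_of_mem_torus hz, one_pow, one_mul,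
          Complex.norm_real, Real.norm_eq_abs]
      rw [dist_eq_norm] at h4
      linarith [norm_le_norm_add_norm_sub' (P (r • z)) (P z)]
    have h7 : ‖m (r • z)‖ ^ M ≤ 1 := pow_le_one₀ (norm_nonneg _)
      ((norm_prod_le_norm hn (hnr.trans hr.2.le)).trans (hnr.trans hr.2.le))
    simp only [hh, norm_div, norm_mul, norm_neg, Complex.norm_ofNat, norm_pow (m (r • z)) M]
    rw [div_le_iff₀ (by linarith)]
    calc 2 * ‖P (r • z)‖ * ‖m (r • z)‖ ^ M ≤ 2 * (2 * (ε * c / 8)) * 1 := by gcongr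
      _ = ε * (c / 2) := by ring
      _ ≤ _ := by
        gcongr
        linarith

/-! ### Summing the blocks. -/

/-- Every integrable real function on the torus is almost everywhere the radial limit of the real
part of a holomorphic function on the polydisc that has radial limits almost everywhere. -/
theorem exists_holomorphic_radialLimit_re {n : ℕ} (hn : n ≠ 0) {φ : (Fin n → ℂ) → ℝ}
    (hφ : Integrable φ (torusMeasure n)) :
    ∃ H Hstar : (Fin n → ℂ) → ℂ, DifferentiableOn ℂ H (polydisc n) ∧
      ∀ᵐ z ∂torusMeasure n, HasRadialLimit H z (Hstar z) ∧ (Hstar z).re = φ z := by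
  set e : ℕ → ℝ := fun k => (1 / 2) ^ k with he
  have he0 : ∀ k, 0 < e k := fun k => by positivity
  have hes : Summable e := summable_geometric_two
  have heE : ∑' k, ENNReal.ofReal (e k) ≠ ⊤ := hes.tsum_ofReal_ne_top
  choose δ hδ hblock using fun k => exists_holomorphic_small hn (he0 k)
  -- Ensures `η k + η (k + 1) ≤ δ k`, the smallness needed of `S (k + 1) - S k`. At `k = 0` the
  -- truncated `k - 1` merely repeats `δ 0`.
  set η : ℕ → ℝ := fun k => min (e k) (min (δ k / 2) (δ (k - 1) / 2)) with hη
  have hη0 : ∀ k, 0 < η k := fun k =>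
    lt_min (he0 k) (lt_min (half_pos (hδ k)) (half_pos (hδ (k - 1))))
  have hηe : ∀ k, η k ≤ e k := fun k => min_le_left _ _
  have hηδ : ∀ k, η k ≤ δ k / 2 := fun k => (min_le_right _ _).trans (min_le_left _ _)
  have hηδ' : ∀ k, η (k + 1) ≤ δ k / 2 := fun k =>
    (min_le_right _ _).trans (min_le_right _ _)
  choose T hT hTm using fun k => exists_isLaurentOnTorus_measure_le hφ (hη0 k)
  -- Starting from zero makes the partial sums telescope to `S K`.
  set S : ℕ → (Fin n → ℂ) → ℝ := fun k => if k = 0 then fun _ => 0 else T k with hS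
  have hSL : ∀ k, IsLaurentOnTorus (S k) := fun k => by
    by_cases hk : k = 0
    · simpa [hS, hk] using IsLaurentOnTorus.const 0
    · simpa [hS, hk] using hT k
  choose h hd hsmall hae E hEm hE using fun k => hblock k _ ((hSL (k + 1)).sub (hSL k))
  have hF : ∀ᵐ z ∂torusMeasure n, ∀ᶠ k in atTop, z ∉ {z | z ∈ torus n ∧ η k < |φ z - T k z|} :=
    ae_eventually_notMem (ne_top_of_le_ne_top heE (ENNReal.tsum_le_tsum fun k =>
      (hTm k).trans (ENNReal.ofReal_le_ofReal (hηe k))))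
  have hE' : ∀ᵐ z ∂torusMeasure n, ∀ᶠ k in atTop, z ∉ E k :=
    ae_eventually_notMem (ne_top_of_le_ne_top heE (ENNReal.tsum_le_tsum hEm))
  refine ⟨fun z => ∑' k, h k z, fun z => ∑' k, h k z, ?_, ?_⟩
  · simp only [polydisc_eq_ball] at hd ⊢
    refine differentiableOn_tsum_ball hes hd fun ρ hρ => ?_
    have h1 : Tendsto e atTop (𝓝 0) := hes.tendsto_atTop_zero
    filter_upwards [h1.eventually_lt_const (sub_pos.2 hρ)] with k hk z hz
    exact hsmall k z (by linarith)
  filter_upwards [ae_mem_torus n, hF, hE', ae_all_iff.2 hae] with z hz hzF hzE hzh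
  have hSφ : ∀ᶠ k in atTop, |φ z - S k z| ≤ η k := by
    filter_upwards [hzF, eventually_ne_atTop 0] with k hk hk0
    simpa [hS, hk0, hz] using hk
  have hbound : ∀ᶠ k in atTop, ∀ r ∈ Set.Ico (0 : ℝ) 1, ‖h k (r • z)‖ ≤ e k := by
    filter_upwards [hSφ, (tendsto_add_atTop_nat 1).eventually hSφ, hzE] with k h1 h2 h3
    refine hE k z hz h3 ?_
    have h4 := abs_sub_le (S (k + 1) z) (φ z) (S k z)
    rw [abs_sub_comm (S (k + 1) z) (φ z)] at h4
    linarith [hηδ k, hηδ' k]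
  have hlim : ∀ k, Tendsto (fun r : ℝ => h k (r • z)) (𝓝[<] 1) (𝓝 (h k z)) := fun k => by
    have h1 : Tendsto (fun r : ℝ => r • z) (𝓝[<] 1) (𝓝 z) := by
      have h2 : Continuous (fun r : ℝ => r • z) := by fun_prop
      exact (h2.tendsto' 1 z (one_smul ℝ z)).mono_left nhdsWithin_le_nhds
    exact (hzh k).1.tendsto.comp h1
  have hIco : ∀ᶠ r : ℝ in 𝓝[<] 1, r ∈ Set.Ico (0 : ℝ) 1 :=
    Ico_mem_nhdsLT zero_lt_one
  obtain ⟨k₀, hk₀⟩ := eventually_atTop.1 hbound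
  -- A summable majorant for `r` near `1`: early terms are bounded through their radial limits,
  -- later ones by `e k`.
  set b : ℕ → ℝ := fun k => if k < k₀ then ‖h k z‖ + 1 else e k with hb
  have hbs : Summable b := by
    refine (summable_congr_cofinite ?_).1 hes
    rw [Nat.cofinite_eq_atTop]
    filter_upwards [eventually_ge_atTop k₀] with k hk
    simp [hb, hk.not_gt]
  have hdom : ∀ᶠ r : ℝ in 𝓝[<] 1, ∀ k, ‖h k (r • z)‖ ≤ b k := by
    have h1 : ∀ᶠ r : ℝ in 𝓝[<] 1, ∀ k ∈ Finset.range k₀, ‖h k (r • z)‖ ≤ ‖h k z‖ + 1 :=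
      (Finset.eventually_all _).2 fun k _ =>
        ((hlim k).norm.eventually_lt_const (lt_add_one _)).mono fun _ hr => hr.le
    filter_upwards [h1, hIco] with r hr1 hr2 k
    by_cases hk : k < k₀
    · simpa [hb, hk] using hr1 k (Finset.mem_range.2 hk)
    · simpa [hb, hk] using hk₀ k (not_lt.1 hk) r hr2
  refine ⟨tendsto_tsum_of_dominated_convergence hbs hlim hdom, ?_⟩
  have hsum : Summable fun k => h k z := Summable.of_norm_bounded hbs fun k =>
    le_of_tendsto (hlim k).norm (hdom.mono fun r hr => hr k)
  rw [Complex.re_tsum hsum]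
  have hre : ∀ k, (h k z).re = S (k + 1) z - S k z := fun k => (hzh k).2
  have htel : Tendsto (fun K => ∑ k ∈ Finset.range K, (h k z).re) atTop (𝓝 (φ z)) := by
    have h1 : ∀ K, ∑ k ∈ Finset.range K, (h k z).re = S K z := fun K => by
      simp only [hre, Finset.sum_range_sub (fun k => S k z)]
      simp [hS]
    simp only [h1]
    rw [tendsto_iff_norm_sub_tendsto_zero]
    refine squeeze_zero' (Eventually.of_forall fun _ => norm_nonneg _) ?_ hes.tendsto_atTop_zero
    filter_upwards [hSφ] with k hk
    rw [Real.norm_eq_abs, abs_sub_comm]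
    exact hk.trans (hηe k)
  exact tendsto_nhds_unique (Complex.hasSum_re hsum.hasSum).summable.hasSum.tendsto_sum_nat htel

/-! ### Averaging over `G` and conclusion. -/

/-- For `n = 0` the empty product is `1` and the blocks degenerate; a constant serves instead. -/
theorem isAdmissible_zero (G : Subgroup (Matrix.unitaryGroup (Fin 0) ℂ)) {w : (Fin 0 → ℂ) → ℝ}
    (hpos : ∀ᵐ z ∂torusMeasure 0, 0 < w z) : IsAdmissible G w := by
  have h0 : 0 < w 0 := by
    have : (torusMeasure 0) ≠ 0 := by
      rw [torusMeasure, Measure.pi_of_empty (x := 0)]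
      exact Measure.dirac_ne_zero
    have : NeBot (ae (torusMeasure 0)) := ae_neBot.2 this
    obtain ⟨z, hz⟩ := hpos.exists
    rwa [Subsingleton.elim z 0] at hz
  refine ⟨fun _ => (Real.sqrt (w 0) : ℂ), by fun_prop, fun z _ => ?_, fun τ _ z _ => rfl,
    fun _ => (Real.sqrt (w 0) : ℂ), ae_of_all _ fun z => tendsto_const_nhds,
    ae_of_all _ fun z => ?_⟩
  · exact Complex.ofReal_ne_zero.2 (Real.sqrt_pos.2 h0).ne'
  · rw [Complex.norm_real, Real.norm_eq_abs, sq_abs, Real.sq_sqrt h0.le, Subsingleton.elim z 0]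

theorem mainTheorem5 (n : ℕ) (G : Subgroup (Matrix.unitaryGroup (Fin n) ℂ)) (hfin : Finite G)
    (hG : GeneratedByRotationsPermutations G)
    (w : (Fin n → ℂ) → ℝ)
    (hcont : ContinuousOn w (torus n))
    (hpos : ∀ᵐ z ∂(torusMeasure n), 0 < w z)
    (hinv : InvariantOn G (torus n) w)
    (hlog : Integrable (fun z => Real.log (w z)) (torusMeasure n)) :
    IsAdmissible G w := by
  rcases eq_or_ne n 0 with rfl | hn
  · exact isAdmissible_zero G hpos
  obtain ⟨H, Hstar, hH, hHstar⟩ := exists_holomorphic_radialLimit_re hn hlog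
  have := Fintype.ofFinite G
  set act : G → (Fin n → ℂ) → (Fin n → ℂ) := fun τ z =>
    ((τ : Matrix.unitaryGroup (Fin n) ℂ) : Matrix (Fin n) (Fin n) ℂ) *ᵥ z with hact
  have hpoly : ∀ τ, ∀ z ∈ polydisc n, act τ z ∈ polydisc n := fun τ z hz => by
    obtain ⟨c, κ, hc, h⟩ := exists_monomialMap_of_mem hG τ.2
    simp only [hact, h]
    exact monomialMap_mem_polydisc hc hz
  have hmp : ∀ τ, MeasurePreserving (act τ) (torusMeasure n) (torusMeasure n) := fun τ => by
    obtain ⟨c, κ, hc, h⟩ := exists_monomialMap_of_mem hG τ.2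
    simp only [hact, h]
    exact measurePreserving_monomialMap c κ hc
  have hactd : ∀ τ, Differentiable ℂ (act τ) := fun τ => by
    obtain ⟨c, κ, hc, h⟩ := exists_monomialMap_of_mem hG τ.2
    simp only [hact, h]
    unfold monomialMap
    fun_prop
  set A : ((Fin n → ℂ) → ℂ) → (Fin n → ℂ) → ℂ := fun F z =>
    (∑ τ : G, F (act τ z)) / Fintype.card G with hA
  -- Finitely many measure-preserving maps pull the exceptional set back to null sets.
  have hae : ∀ᵐ z ∂torusMeasure n, ∀ τ : G,
      HasRadialLimit H (act τ z) (Hstar (act τ z)) ∧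
        (Hstar (act τ z)).re = Real.log (w (act τ z)) :=
    ae_all_iff.2 fun τ => (hmp τ).quasiMeasurePreserving.ae hHstar
  refine ⟨fun z => Complex.exp (A H z / 2), ?_, fun z _ => Complex.exp_ne_zero _,
    fun σ hσ z _ => ?_, fun z => Complex.exp (A Hstar z / 2), ?_, ?_⟩
  · have h1 : ∀ τ : G, DifferentiableOn ℂ (fun z => H (act τ z)) (polydisc n) := fun τ =>
      hH.comp (hactd τ).differentiableOn (hpoly τ)
    have h2 : DifferentiableOn ℂ (A H) (polydisc n) := by
      change DifferentiableOn ℂ (fun z => (∑ τ : G, H (act τ z)) / Fintype.card G) (polydisc n)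
      simp only [div_eq_mul_inv]
      exact (DifferentiableOn.fun_sum fun τ _ => h1 τ).mul_const _
    simp only [div_eq_mul_inv]
    exact (h2.mul_const _).cexp
  · have h1 : ∑ τ : G, H (act τ ((σ : Matrix (Fin n) (Fin n) ℂ) *ᵥ z)) = ∑ τ : G, H (act τ z) :=
      Fintype.sum_equiv (Equiv.mulRight (⟨σ, hσ⟩ : G)) _ _ fun τ => by
        simp [hact, Matrix.mulVec_mulVec]
    simp only [hA, h1]
  · filter_upwards [hae] with z hz
    refine (Complex.continuous_exp.tendsto _).comp (Tendsto.div_const (Tendsto.div_const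
      (tendsto_finsetSum _ fun τ _ => ?_) _) _)
    simpa only [HasRadialLimit, hact, Matrix.mulVec_smul] using (hz τ).1
  · filter_upwards [hae, hpos, ae_mem_torus n] with z hz hw hzt
    have h3 : (A Hstar z / 2).re = Real.log (w z) / 2 := by
      have h4 : ∑ τ : G, (Hstar (act τ z)).re = Fintype.card G * Real.log (w z) := by
        rw [Finset.sum_congr rfl fun τ _ => (hz τ).2.trans
          (congrArg Real.log (hinv τ τ.2 z hzt))]
        simp
      simp only [hA]
      rw [Complex.div_ofNat_re, Complex.div_natCast_re, Complex.re_sum, h4,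
        mul_div_cancel_left₀ _ (Nat.cast_ne_zero.2 Fintype.card_ne_zero)]
    rw [Complex.norm_exp, h3, ← Real.exp_nat_mul]
    push_cast
    rw [mul_div_cancel₀ _ two_ne_zero, Real.exp_log hw]
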